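/- Let $k$ be a field, let $G$ be a group, and let $kG$ be its group algebra. If the (right, Gabriel–Rentschler) Krull dimension $\operatorname{Kdim} kG$ exists, then $G$ is amenable. Here the deviation of a partially ordered set $A$ is defined as follows. If no two distinct elements of $A$ are comparable, then $A$ has deviation $-\infty$. For an ordinal $\alpha$, $A$ has deviation $\alpha$ if $A$ does not have deviation $\beta$ for any $\beta<\alpha$ (including $\beta=-\infty$), and for every descending chain $a_0\ge a_1\ge a_2\ge\cdots$ in $A$, for all but finitely many $n$ the factor $\{x\in A : a_{n+1}\le x\le a_n\}$ has a deviation that is less than $\alpha$. The right Krull dimension $\operatorname{Kdim} R$ of a ring $R$ is the deviation of its lattice of right ideals; it exists if this lattice has a deviation. The group $G$ is amenable if there is a map $\mu$ from the set of all subsets of $G$ to $[0,1]$ such that $\mu(G)=1$, $\mu(A\cup B)=\mu(A)+\mu(B)$ for all disjoint $A,B\subseteq G$, and $\mu(A)=\mu(gA)=\mu(Ag)$ for all $A\subseteq G$ and $g\in G$. -/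

import Mathlib

universe w

/-- `IsDeviation s α` says that the partially ordered set `s` (with the order induced from `P`) has
deviation `α`, where `⊥` plays the role of `-∞`:
* `s` has deviation `-∞` if it is trivial, i.e. no two distinct elements of `s` are comparable;
* for an ordinal `α`, `s` has deviation `α` if it does not have deviation `β` for any `β < α`, and
  in every descending chain `f 0 ≥ f 1 ≥ ⋯` of elements of `s`, all but finitely many of the
  factors `{x ∈ s | f (n + 1) ≤ x ≤ f n}` have a deviation that is less than `α`.

In particular `s` has deviation `0` if it is non-trivial and satisfies the descending chain
condition. A partially ordered set need not have a deviation. -/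
def IsDeviation {P : Type*} [PartialOrder P] (s : Set P) (α : WithBot Ordinal.{w}) : Prop :=
  (α = ⊥ ∧ ∀ a ∈ s, ∀ b ∈ s, a ≤ b → a = b) ∨
  (α ≠ ⊥ ∧ (∀ β, ∀ _ : β < α, ¬ IsDeviation s β) ∧
    ∀ f : ℕ → P, Antitone f → (∀ n, f n ∈ s) →
      ∃ N, ∀ n ≥ N, ∃ β, ∃ _ : β < α, IsDeviation (s ∩ Set.Icc (f (n + 1)) (f n)) β)
termination_by (wellFounded_lt (α := WithBot Ordinal.{w})).wrap α
decreasing_by all_goals assumption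

/-- The (right, Gabriel–Rentschler) Krull dimension of the ring `R` exists and equals `α`: the
lattice of right ideals of `R` has deviation `α`. Right ideals are the submodules of the right
`R`-module `R`. -/
def IsRightKrullDim (R : Type*) [Ring R] (α : WithBot Ordinal.{w}) : Prop :=
  IsDeviation (Set.univ : Set (Submodule Rᵐᵒᵖ R)) α

/-- A finitely additive (two-sided) invariant probability measure on all subsets of `G`. -/
structure IsInvariantMean {G : Type*} [Group G] (μ : Set G → ℝ) : Prop where
  mem_Icc : ∀ A, μ A ∈ Set.Icc (0 : ℝ) 1
  univ : μ Set.univ = 1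
  union : ∀ A B, A ∩ B = ∅ → μ (A ∪ B) = μ A + μ B
  left_inv : ∀ (g : G) (A : Set G), μ ((fun x => g * x) '' A) = μ A
  right_inv : ∀ (g : G) (A : Set G), μ ((fun x => x * g) '' A) = μ A

/-- A (discrete) group is amenable if it has a finitely additive invariant probability measure. -/
def IsAmenableGroup (G : Type*) [Group G] : Prop :=
  ∃ μ : Set G → ℝ, IsInvariantMean μ

/-!
Suppose that `G` is not amenable. The argument produces an order embedding of `ℚ` into the lattice
of right ideals of `kG`, and a partially ordered set containing a copy of `ℚ` has no deviation
(`not_isDeviation_of_strictMono_rat`: a decreasing sequence of rationals cuts it into factors each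
of which again contains a copy of `ℚ`).

*Expansion.* If `G` had, for every finite `E` and `δ > 0`, a nonempty finite `F` with
`#(E * F) < (1 + δ) * #F`, then the ultralimit of the densities `#{(x, y) ∈ F × F | x * y⁻¹ ∈ A} /
#F ^ 2` would be a two-sided invariant mean. So some `E` expands every `F` by a factor `1 + δ`, and
`S = E ^ n` expands by `(1 + δ) ^ n`, whereas `#S ≤ 2 ^ l` for some `l` linear in `n`. For large `n`
the expansion factor exceeds `8 * (l + 2)` (`exists_card_le_two_pow_and_card_mul_gt`).

*Isolation.* Choose a random subset `Z` of `S` by first choosing a density `2 ^ (-i)`, with `i` at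
most `l + 1`, and then keeping each point with that probability. For `s ∈ I ⊆ S`,
the event `Z ∩ I = {s}` has probability at least `1 / (8 * (l + 2) * #I)`. Since
`∑ 1 / #{t ∈ S | t⁻¹ * s * f ∈ F}` over `s ∈ S`, `f ∈ F` equals `#(S * F)`, averaging over `f`
shows that the expansion beats the loss of `8 * (l + 2)`: for each `F` there is `f ∈ F` such that
the expected number of `s ∈ Z` for which `s` is the only `t ∈ Z` with `t⁻¹ * s * f ∈ F` is greater than
`1` (`exists_isolating_family`).

*Linear algebra.* Let `Y` be the finite set of all outcomes `y`, giving sets `Z y`, and let `L / k`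
be a finite field extension with distinct elements `α (s, y)`. A finitely supported
`X : G → L ^ (#Y + 1)` is sent to the function
`g ↦ (∑ s ∈ Z y, ∑ i, α (s, y) ^ i * X (s⁻¹ * g) i)` with values in `L ^ Y`. If the image of some
`X ≠ 0` vanishes, then at the point `f` of the support `F` of `X` given by the isolation property, the
polynomial with coefficients `X f` has more than `#Y` roots, so `X f = 0`, a contradiction. Hence the map is
injective, and over `k` it is left multiplication by a matrix over `kG` with more columns than rows
(`exists_injective_mulVecRight`).

*Dense chains.* An injection of right modules `R ^ m → R ^ n` with `n < m` makes `R ^ n` contain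
`R ^ n × R`, hence an infinite direct sum of copies of `R`, hence a chain of submodules of order
type `ℚ`. Given a chain of type `ℚ` of submodules of an extension, either the traces on the kernel or the
images in the quotient contain such a chain, so one descends from `R ^ n` to `R`
(`exists_strictMono_rat_submodule`).
-/

universe u

/-! ### Dense chains and deviation -/

theorem exists_strictMono_rat_mem_Icc {a b : ℚ} (h : a < b) :
    ∃ g : ℚ → ℚ, StrictMono g ∧ ∀ q, g q ∈ Set.Icc a b := by
  have : Nontrivial (Set.Icc a b) :=
    ⟨⟨a, Set.left_mem_Icc.2 h.le⟩, ⟨b, Set.right_mem_Icc.2 h.le⟩,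
      fun H => h.ne (congrArg Subtype.val H)⟩
  obtain ⟨e⟩ := Order.embedding_from_countable_to_dense (α := ℚ) (β := Set.Icc a b)
  exact ⟨fun q => e q, fun p q hpq => e.strictMono hpq, fun q => (e q).2⟩

theorem not_isDeviation_of_strictMono_rat {P : Type*} [PartialOrder P] (α : WithBot Ordinal.{w}) :
    ∀ (s : Set P) (f : ℚ → P), StrictMono f → (∀ q, f q ∈ s) → ¬ IsDeviation s α := by
  induction α using WellFoundedLT.induction with
  | ind α ih =>
    intro s f hf hs h
    rw [IsDeviation] at h
    rcases h with ⟨-, h⟩ | ⟨-, -, h⟩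
    · exact (hf zero_lt_one).ne (h _ (hs 0) _ (hs 1) (hf zero_lt_one).le)
    · obtain ⟨N, hN⟩ := h (fun n => f (-(n : ℚ))) (fun m n hmn => hf.monotone (by simpa using hmn))
        (fun n => hs _)
      obtain ⟨β, hβ, hd⟩ := hN N le_rfl
      obtain ⟨g, hg, hgm⟩ := exists_strictMono_rat_mem_Icc
        (show (-((N + 1 : ℕ) : ℚ)) < -(N : ℚ) by push_cast; linarith)
      refine ih β hβ _ (f ∘ g) (hf.comp hg) (fun q => ?_) hd
      exact ⟨hs _, hf.monotone (hgm q).1, hf.monotone (hgm q).2⟩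

/-- If `f` and `g` never stagnate simultaneously, then either `f` is strictly monotone or `g` is
strictly monotone on an interval on which `f` is constant. -/
theorem exists_strictMono_rat_or {A B : Type*} [PartialOrder A] [PartialOrder B]
    {f : ℚ → A} {g : ℚ → B} (hf : Monotone f) (hg : Monotone g)
    (h : ∀ p q, p < q → f p = f q → g p ≠ g q) :
    (∃ f' : ℚ → A, StrictMono f') ∨ ∃ g' : ℚ → B, StrictMono g' := by
  by_cases hc : ∃ p q, p < q ∧ f p = f q
  · obtain ⟨p, q, hpq, he⟩ := hc
    obtain ⟨e, he', hm⟩ := exists_strictMono_rat_mem_Icc hpq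
    have hconst : ∀ r, f (e r) = f p := fun r =>
      le_antisymm ((hf (hm r).2).trans he.ge) (hf (hm r).1)
    exact Or.inr ⟨g ∘ e, fun r t hrt => (hg (he' hrt).le).lt_of_ne
      (h _ _ (he' hrt) ((hconst r).trans (hconst t).symm))⟩
  · push Not at hc
    exact Or.inl ⟨f, fun p q hpq => (hf hpq.le).lt_of_ne (hc p q hpq)⟩

section Modules

variable {A B : Type*} [Ring A] [AddCommGroup B] [Module A B]

/-- A chain of submodules of `M` is determined by its traces on the kernel of `e` and its images
under `e`, so one of the two inherits a dense chain. -/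
theorem exists_strictMono_rat_ker_or_codomain {M M' : Type*} [AddCommGroup M] [Module A M]
    [AddCommGroup M'] [Module A M'] (e : M →ₗ[A] M') {F : ℚ → Submodule A M} (hF : StrictMono F) :
    (∃ F' : ℚ → Submodule A e.ker, StrictMono F') ∨ ∃ F' : ℚ → Submodule A M', StrictMono F' := by
  refine exists_strictMono_rat_or (f := fun q => (F q).comap e.ker.subtype)
    (g := fun q => (F q).map e) (fun p q h => Submodule.comap_mono (hF.monotone h))
    (fun p q h => Submodule.map_mono (hF.monotone h)) fun p q hpq hk hm => (hF hpq).not_ge ?_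
  intro x hx
  obtain ⟨y, hy, hxy⟩ : e x ∈ (F p).map e := by
    rw [show (F p).map e = (F q).map e from hm]
    exact Submodule.mem_map_of_mem hx
  have hker : x - y ∈ e.ker := by simp [hxy]
  have hmem : (⟨x - y, hker⟩ : e.ker) ∈ (F p).comap e.ker.subtype := by
    rw [show (F p).comap e.ker.subtype = (F q).comap e.ker.subtype from hk]
    exact sub_mem hx ((hF hpq).le hy)
  simpa using add_mem (show x - y ∈ F p from hmem) hy

theorem exists_strictMono_rat_of_injective_pi (n : ℕ) :
    ∀ {M : Type*} [AddCommGroup M] [Module A M] (j : M →ₗ[A] (Fin n → B)),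
      Function.Injective j → (∃ F : ℚ → Submodule A M, StrictMono F) →
      ∃ F : ℚ → Submodule A B, StrictMono F := by
  induction n with
  | zero =>
    rintro M _ _ j hj ⟨F, hF⟩
    have := hj.subsingleton
    exact absurd (Subsingleton.elim _ _) (hF zero_lt_one).ne
  | succ n ih =>
    rintro M _ _ j hj ⟨F, hF⟩
    obtain h | h := exists_strictMono_rat_ker_or_codomain ((LinearMap.proj 0).comp j) hF
    · refine ih ((LinearMap.funLeft A B Fin.succ).comp (j.comp (Submodule.subtype _))) ?_ h
      intro x y hxy
      refine Subtype.ext (hj (funext fun i => ?_))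
      refine Fin.cases ?_ (fun i => congrFun hxy i) i
      exact (LinearMap.mem_ker.1 x.2).trans (LinearMap.mem_ker.1 y.2).symm
    · exact h

/-- The images of the submodules supported on initial segments of `ℚ` form a dense chain; the
copies of `B` are indexed by `ℚ` by means of an encoding of `ℚ` in `ℕ`. -/
theorem exists_strictMono_rat_of_injective_finsupp [Nontrivial B] {Q : Type*} [AddCommGroup Q]
    [Module A Q] (Ψ : (ℕ →₀ B) →ₗ[A] Q) (hΨ : Function.Injective Ψ) :
    ∃ F : ℚ → Submodule A Q, StrictMono F := by
  obtain ⟨b, hb⟩ := exists_ne (0 : B)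
  refine ⟨fun q => (Finsupp.supported B A (Encodable.encode '' Set.Iio q)).map Ψ, fun p q hpq =>
    Submodule.map_strictMono_of_injective hΨ (lt_of_le_not_ge (Finsupp.supported_mono
      (Set.image_mono (Set.Iio_subset_Iio hpq.le))) fun h => ?_)⟩
  have h1 : Finsupp.single (Encodable.encode p) b ∈
      Finsupp.supported B A (Encodable.encode '' Set.Iio p) :=
    h (Finsupp.single_mem_supported A b ⟨p, hpq, rfl⟩)
  rw [Finsupp.mem_supported, Finsupp.support_single _ hb] at h1
  obtain ⟨r, hr, he⟩ := h1 (Finset.mem_coe.2 (Finset.mem_singleton_self _))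
  exact (ne_of_lt hr) (Encodable.encode_injective he)

/-- If `(a, b) : Q × B → Q` is injective, then the images of `B` under `b`, `a * b`, `a ^ 2 * b`, …
form a direct sum of copies of `B`. -/
theorem eq_zero_of_sum_pow_eq_zero {Q : Type*} [AddCommGroup Q] [Module A Q] (a : Module.End A Q)
    (b : B →ₗ[A] Q) (h : ∀ x y, a x + b y = 0 → x = 0 ∧ y = 0) (n : ℕ) :
    ∀ x : ℕ → B, ∑ i ∈ Finset.range n, (a ^ i) (b (x i)) = 0 → ∀ i < n, x i = 0 := by
  induction n with
  | zero => intro x _ i hi; omega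
  | succ n ih =>
    intro x hx
    have hx' : a (∑ i ∈ Finset.range n, (a ^ i) (b (x (i + 1)))) + b (x 0) = 0 := by
      rw [← hx, Finset.sum_range_succ', map_sum]
      simp [pow_succ']
    obtain ⟨h1, h2⟩ := h _ _ hx'
    rintro (_ | i) hi
    · exact h2
    · exact ih (fun i => x (i + 1)) h1 i (by omega)

theorem exists_strictMono_rat_of_injective_prod [Nontrivial B] {Q : Type*} [AddCommGroup Q]
    [Module A Q] (θ : Q × B →ₗ[A] Q) (hθ : Function.Injective θ) :
    ∃ F : ℚ → Submodule A Q, StrictMono F := by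
  set a : Module.End A Q := θ.comp (LinearMap.inl A Q B)
  set b : B →ₗ[A] Q := θ.comp (LinearMap.inr A Q B)
  have hab : ∀ x y, a x + b y = 0 → x = 0 ∧ y = 0 := by
    intro x y h
    have : θ (x, y) = 0 := by
      rw [← h]
      simp [a, b, ← map_add]
    simpa using (map_eq_zero_iff θ hθ).1 this
  refine exists_strictMono_rat_of_injective_finsupp
    (Finsupp.lsum ℕ fun i => (a ^ i).comp b) ((injective_iff_map_eq_zero _).2 fun x hx => ?_)
  obtain ⟨n, hn⟩ := x.support.exists_nat_subset_range
  rw [Finsupp.lsum_apply, Finsupp.sum_of_support_subset _ hn _ (by simp)] at hx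
  ext i
  by_cases hi : i < n
  · exact eq_zero_of_sum_pow_eq_zero a b hab n x hx i hi
  · exact Finsupp.notMem_support_iff.1 fun h => hi (Finset.mem_range.1 (hn h))

/-- If a finite power of `B` embeds in a smaller power, then the lattice of submodules of `B` itself
contains a dense chain. -/
theorem exists_strictMono_rat_submodule [Nontrivial B] {ι κ : Type*} [Fintype ι] [Fintype κ]
    (hcard : Fintype.card κ < Fintype.card ι) (φ : (ι → B) →ₗ[A] (κ → B))
    (hφ : Function.Injective φ) : ∃ F : ℚ → Submodule A B, StrictMono F := by
  obtain ⟨e⟩ : Nonempty (Option κ ↪ ι) :=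
    Function.Embedding.nonempty_of_card_le (by simpa using hcard)
  let θ : (κ → B) × B →ₗ[A] (ι → B) :=
    { toFun := fun x => Function.extend e (fun o => o.elim x.2 x.1) 0
      map_add' := fun x y => by
        rw [← Function.extend_add, add_zero]
        congr 1
        ext o
        cases o <;> rfl
      map_smul' := fun r x => by
        rw [RingHom.id_apply, ← Function.extend_smul, smul_zero]
        congr 1
        ext o
        cases o <;> rfl }
  have hθ : Function.Injective θ := by
    intro x y h
    have h' : ∀ o : Option κ, o.elim x.2 x.1 = o.elim y.2 y.1 := fun o => by
      have := congrFun h (e o)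
      simpa only [θ, LinearMap.coe_mk, AddHom.coe_mk, e.injective.extend_apply] using this
    exact Prod.ext (funext fun i => h' (some i)) (h' none)
  refine exists_strictMono_rat_of_injective_pi (B := B) (Fintype.card κ)
    (LinearEquiv.funCongrLeft A B (Fintype.equivFin κ).symm).toLinearMap
    (LinearEquiv.injective _) ?_
  exact exists_strictMono_rat_of_injective_prod (φ.comp θ) (hφ.comp hθ)

end Modules

/-! ### Expansion in groups that are not amenable -/

section Amenable

open scoped Pointwise

variable {G : Type*} [Group G]

open Classical in
/-- The proportion of the pairs `(x, y)` in `F × F` with `x * y⁻¹ ∈ A`. -/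
noncomputable def quotientDensity (F : Finset G) (A : Set G) : ℝ :=
  ({p ∈ F ×ˢ F | p.1 * p.2⁻¹ ∈ A}.card : ℝ) / (F.card : ℝ) ^ 2

theorem quotientDensity_mem_Icc (F : Finset G) (A : Set G) :
    quotientDensity F A ∈ Set.Icc (0 : ℝ) 1 := by
  classical
  refine ⟨by unfold quotientDensity; positivity, div_le_one_of_le₀ ?_ (by positivity)⟩
  have := Finset.card_filter_le (F ×ˢ F) fun p => p.1 * p.2⁻¹ ∈ A
  rw [Finset.card_product, ← sq] at this
  exact_mod_cast this

theorem quotientDensity_univ {F : Finset G} (hF : F.Nonempty) :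
    quotientDensity F Set.univ = 1 := by
  classical
  have : (F.card : ℝ) ≠ 0 := by exact_mod_cast hF.card_pos.ne'
  simp only [quotientDensity, Set.mem_univ, Finset.filter_true, Finset.card_product]
  push_cast
  field_simp

theorem quotientDensity_union (F : Finset G) {A B : Set G} (h : A ∩ B = ∅) :
    quotientDensity F (A ∪ B) = quotientDensity F A + quotientDensity F B := by
  classical
  rw [quotientDensity, quotientDensity, quotientDensity, ← add_div, ← Nat.cast_add,
    ← Finset.card_union_of_disjoint, ← Finset.filter_or]
  · simp only [Set.mem_union]
  · exact Finset.disjoint_filter.2 fun p _ h1 h2 =>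
      (Set.mem_empty_iff_false _).1 (h.le (Set.mem_inter h1 h2))

theorem quotientDensity_inv (F : Finset G) (A : Set G) :
    quotientDensity F A⁻¹ = quotientDensity F A := by
  classical
  rw [quotientDensity, quotientDensity]
  congr 2
  refine Finset.card_nbij' Prod.swap Prod.swap ?_ ?_ (fun _ _ => rfl) fun _ _ => rfl <;>
  · rintro ⟨x, y⟩ h
    simpa [and_comm, and_left_comm] using h

open Classical in
/-- Almost invariance of the density on an almost invariant set: a pair counted on the left but not
moved to one counted on the right has its first entry among the at most `δ * #F` points of `F` which
`g⁻¹` moves out of `F`. -/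
theorem quotientDensity_image_mul_left_le (F : Finset G) (A : Set G) (g : G) {δ : ℝ} {E : Finset G}
    (h1 : 1 ∈ E) (hg : g⁻¹ ∈ E) (hE : ((E * F).card : ℝ) ≤ (1 + δ) * F.card) (hF : F.Nonempty) :
    quotientDensity F ((fun x => g * x) '' A) ≤ quotientDensity F A + δ := by
  have hpos : (0 : ℝ) < F.card := by exact_mod_cast hF.card_pos
  -- the points of `F` which `g⁻¹` moves out of `F`
  set D := F.filter fun x => g⁻¹ * x ∉ F with hD
  have hDcard : D.card + F.card ≤ (E * F).card := by
    have hsub : F ⊆ E * F := fun x hx => by simpa using Finset.mul_mem_mul h1 hx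
    rw [← Finset.card_sdiff_add_card_eq_card hsub]
    refine Nat.add_le_add_right (Finset.card_le_card_of_injOn (fun x => g⁻¹ * x) (fun x hx => ?_)
      (mul_right_injective _).injOn) _
    have hx := Finset.mem_filter.1 (Finset.mem_coe.1 hx)
    exact Finset.mem_coe.2 (Finset.mem_sdiff.2 ⟨Finset.mul_mem_mul hg hx.1, hx.2⟩)
  have hcount : ((F ×ˢ F).filter fun p => p.1 * p.2⁻¹ ∈ (fun x => g * x) '' A).card ≤
      ((F ×ˢ F).filter fun p => p.1 * p.2⁻¹ ∈ A).card + D.card * F.card := by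
    rw [← Finset.card_product, ← Finset.card_filter_add_card_filter_not
      (s := (F ×ˢ F).filter _) (fun p : G × G => g⁻¹ * p.1 ∈ F)]
    refine Nat.add_le_add (Finset.card_le_card_of_injOn (fun p => (g⁻¹ * p.1, p.2)) ?_ ?_)
      (Finset.card_le_card ?_)
    · rintro ⟨x, y⟩ h
      simp only [Finset.coe_filter, Finset.mem_filter, Finset.mem_product, Set.mem_ofPred_eq,
        Set.mem_image] at h ⊢
      obtain ⟨⟨⟨hx, hy⟩, a, ha, hax⟩, hgx⟩ := h
      refine ⟨⟨hgx, hy⟩, ?_⟩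
      rwa [mul_assoc, ← hax, inv_mul_cancel_left]
    · rintro ⟨x, y⟩ - ⟨x', y'⟩ - h
      simpa using h
    · rintro ⟨x, y⟩ h
      simp only [Finset.mem_filter, Finset.mem_product] at h
      simp only [hD, Finset.mem_product, Finset.mem_filter]
      exact ⟨⟨h.1.1.1, h.2⟩, h.1.1.2⟩
  have hD' : (D.card : ℝ) ≤ δ * F.card := by
    have : (D.card : ℝ) + F.card ≤ (E * F).card := by exact_mod_cast hDcard
    linarith
  rw [quotientDensity, quotientDensity, div_add' _ _ _ (by positivity)]
  refine div_le_div_of_nonneg_right ?_ (by positivity)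
  calc _ ≤ (((F ×ˢ F).filter fun p => p.1 * p.2⁻¹ ∈ A).card : ℝ) + D.card * F.card := by
        exact_mod_cast hcount
    _ ≤ _ := by nlinarith

open Classical in
/-- The Følner condition implies amenability. The limit of the densities is left invariant because
the sets are almost left invariant, and it is right invariant because the density of `A` is that of
`A⁻¹`. -/
theorem isAmenableGroup_of_forall_exists_card_mul_lt
    (h : ∀ (E : Finset G) (δ : ℝ), 0 < δ →
      ∃ F : Finset G, F.Nonempty ∧ ((E * F).card : ℝ) < (1 + δ) * F.card) :
    IsAmenableGroup G := by
  choose F hFne hF using fun i : Finset G × ℕ => h i.1 (1 / ((i.2 : ℝ) + 1)) Nat.one_div_pos_of_nat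
  let U : Ultrafilter (Finset G × ℕ) := Ultrafilter.of Filter.atTop
  have hU : (U : Filter (Finset G × ℕ)) ≤ Filter.atTop := Ultrafilter.of_le _
  have hlim : ∀ A : Set G, ∃ a ∈ Set.Icc (0 : ℝ) 1,
      Filter.Tendsto (fun i => quotientDensity (F i) A) U (nhds a) := fun A =>
    isCompact_Icc.ultrafilter_le_nhds (U.map fun i => quotientDensity (F i) A)
      (Filter.tendsto_principal.2 (Filter.Eventually.of_forall fun i =>
        quotientDensity_mem_Icc (F i) A))
  choose μ hμ hlim using hlim
  have hinv : ∀ A, μ A⁻¹ = μ A := fun A =>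
    tendsto_nhds_unique (hlim A⁻¹) ((hlim A).congr fun i => (quotientDensity_inv (F i) A).symm)
  have hle : ∀ (g : G) (A : Set G), μ ((fun x => g * x) '' A) ≤ μ A := by
    intro g A
    have h0 : Filter.Tendsto (fun i : Finset G × ℕ => 1 / ((i.2 : ℝ) + 1)) U (nhds 0) :=
      (tendsto_one_div_add_atTop_nhds_zero_nat (𝕜 := ℝ)).comp
        ((Filter.tendsto_snd (f := Filter.atTop (α := Finset G))).comp
          (hU.trans Filter.prod_atTop_atTop_eq.ge))
    have h1 := (hlim A).add h0
    rw [add_zero] at h1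
    refine le_of_tendsto_of_tendsto (hlim _) h1 ?_
    filter_upwards [hU (Filter.eventually_ge_atTop (({1, g⁻¹} : Finset G), 0))] with i hi
    exact quotientDensity_image_mul_left_le (F i) A g (hi.1 (by simp)) (hi.1 (by simp)) (hF i).le
      (hFne i)
  have hleft : ∀ (g : G) (A : Set G), μ ((fun x => g * x) '' A) = μ A := by
    intro g A
    refine (hle g A).antisymm ?_
    have := hle g⁻¹ ((fun x => g * x) '' A)
    rwa [Set.image_image, show (fun x => g⁻¹ * (g * x)) = id from funext fun x => by simp,
      Set.image_id] at this
  refine ⟨μ, hμ, ?_, ?_, hleft, ?_⟩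
  · exact tendsto_nhds_unique (hlim _)
      (tendsto_const_nhds.congr fun i => (quotientDensity_univ (hFne i)).symm)
  · intro A B hAB
    exact tendsto_nhds_unique (hlim _)
      (((hlim A).add (hlim B)).congr fun i => (quotientDensity_union (F i) hAB).symm)
  · intro g A
    rw [← hinv A, ← hleft g⁻¹ A⁻¹, ← hinv]
    congr 1
    ext x
    simp only [Set.mem_inv, Set.mem_image]
    constructor
    · rintro ⟨a, ha, hax⟩
      exact ⟨a⁻¹, by simpa using ha, by rw [← mul_inv_rev, hax, inv_inv]⟩
    · rintro ⟨a, ha, hax⟩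
      exact ⟨a⁻¹, ha, inv_injective (by rw [mul_inv_rev, inv_inv, hax, inv_inv])⟩

open Classical in
theorem pow_mul_card_le_card_pow_mul {E : Finset G} {r : ℝ} (hr : 0 < r)
    (hE : ∀ F : Finset G, F.Nonempty → r * F.card ≤ (E * F).card) (n : ℕ) :
    ∀ F : Finset G, F.Nonempty → r ^ n * F.card ≤ (E ^ n * F).card := by
  induction n with
  | zero => intro F _; simp
  | succ n ih =>
    intro F hF
    have hpos : (0 : ℝ) < F.card := by exact_mod_cast hF.card_pos
    have hne : (E * F).Nonempty := by
      rw [← Finset.card_pos, ← Nat.cast_pos (α := ℝ)]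
      exact (mul_pos hr hpos).trans_le (hE F hF)
    calc r ^ (n + 1) * F.card = r ^ n * (r * F.card) := by ring
      _ ≤ r ^ n * (E * F).card := by gcongr; exact hE F hF
      _ ≤ (E ^ n * (E * F)).card := ih _ hne
      _ = _ := by rw [pow_succ, mul_assoc]

theorem exists_linear_lt_pow (a : ℕ) {r : ℝ} (hr : 1 < r) :
    ∃ n : ℕ, 8 * ((n * a : ℕ) + 2 : ℝ) < r ^ n := by
  have h1 := tendsto_pow_const_div_const_pow_of_one_lt 1 hr
  have h2 := tendsto_pow_atTop_atTop_of_one_lt hr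
  obtain ⟨n, hn1, hn2⟩ := ((h1.eventually (gt_mem_nhds
    (show (0 : ℝ) < 1 / (16 * (a + 1)) by positivity))).and (h2.eventually_gt_atTop 32)).exists
  refine ⟨n, ?_⟩
  rw [pow_one, div_lt_div_iff₀ (by positivity) (by positivity)] at hn1
  push_cast
  nlinarith [Nat.cast_nonneg (α := ℝ) n]

open Classical in
/-- In a group that is not amenable, some finite set `S` expands all finite sets by a factor which
is large compared to the logarithm of `#S`. -/
theorem exists_card_le_two_pow_and_card_mul_gt (h : ¬ IsAmenableGroup G) :
    ∃ (S : Finset G) (l : ℕ), S.card ≤ 2 ^ l ∧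
      ∀ F : Finset G, F.Nonempty → 8 * (l + 2 : ℝ) * F.card < (S * F).card := by
  have h' := mt isAmenableGroup_of_forall_exists_card_mul_lt h
  push Not at h'
  obtain ⟨E, δ, hδ, hE⟩ := h'
  obtain ⟨n, hn⟩ := exists_linear_lt_pow E.card (show 1 < 1 + δ by linarith)
  refine ⟨E ^ n, n * E.card, ?_, fun F hF => ?_⟩
  · calc (E ^ n).card ≤ E.card ^ n := Finset.card_pow_le
      _ ≤ (2 ^ E.card) ^ n := Nat.pow_le_pow_left Nat.lt_two_pow_self.le n
      _ = 2 ^ (n * E.card) := by rw [← pow_mul, mul_comm]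
  · refine lt_of_lt_of_le ?_ (pow_mul_card_le_card_pow_mul (by linarith) hE n F hF)
    have hpos : (0 : ℝ) < F.card := by exact_mod_cast hF.card_pos
    exact mul_lt_mul_of_pos_right hn hpos

end Amenable

/-! ### Random subsets isolating a point -/

section Combinatorics

open scoped Pointwise

/-- The set of points at which a function `h` takes a value below `2 ^ (l + 1 - i)`: if `h` is a
uniformly random function to `Fin (2 ^ (l + 1))`, this is a random set to which every point belongs
independently with probability `2 ^ (-i)`. -/
def levelSet {σ : Type*} [Fintype σ] {l : ℕ} (y : Fin (l + 2) × (σ → Fin (2 ^ (l + 1)))) :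
    Finset σ :=
  {t | (y.2 t : ℕ) < 2 ^ (l + 1 - (y.1 : ℕ))}

/-- The number of functions `h` for which `s` is the only point of `I` with `h s < K`. The factor
`M ^ #I` avoids a subtraction in the exponent of `M`. -/
theorem card_filter_isolated {σ : Type*} [Fintype σ] [DecidableEq σ] {M K : ℕ} (hKM : K ≤ M)
    (I : Finset σ) {s : σ} (hs : s ∈ I) :
    ((Finset.univ.filter fun h : σ → Fin M =>
      (h s : ℕ) < K ∧ ∀ t ∈ I, (h t : ℕ) < K → t = s).card : ℝ) * M ^ I.card =
      K * (M - K : ℝ) ^ (I.card - 1) * M ^ Fintype.card σ := by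
  have hlt : (Finset.univ.filter fun a : Fin M => (a : ℕ) < K).card = K := by
    rw [Fin.card_filter_val_lt, min_eq_right hKM]
  have hge : (Finset.univ.filter fun a : Fin M => ¬ (a : ℕ) < K).card = M - K := by
    have := Finset.card_filter_add_card_filter_not (s := (Finset.univ : Finset (Fin M)))
      fun a : Fin M => (a : ℕ) < K
    rw [hlt, Finset.card_univ, Fintype.card_fin] at this
    omega
  have hpi : (Finset.univ.filter fun h : σ → Fin M =>
      (h s : ℕ) < K ∧ ∀ t ∈ I, (h t : ℕ) < K → t = s) =
      Fintype.piFinset fun t => if t = s then Finset.univ.filter fun a : Fin M => (a : ℕ) < K else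
        if t ∈ I then Finset.univ.filter fun a : Fin M => ¬ (a : ℕ) < K else Finset.univ := by
    ext h
    simp only [Finset.mem_filter, Finset.mem_univ, true_and, Fintype.mem_piFinset]
    constructor
    · rintro ⟨h1, h2⟩ t
      split_ifs with h3 h4
      · simpa [h3] using h1
      · exact Finset.mem_filter.2 ⟨Finset.mem_univ _, fun h5 => h3 (h2 t h4 h5)⟩
      · simp
    · intro H
      refine ⟨by simpa using H s, fun t ht hK => ?_⟩
      by_contra hne
      have := H t
      rw [if_neg hne, if_pos ht] at this
      exact (Finset.mem_filter.1 this).2 hK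
  rw [hpi, Fintype.card_piFinset, ← Finset.prod_mul_prod_compl I, ← Finset.mul_prod_erase I _ hs,
    if_pos rfl, hlt, Finset.prod_congr rfl (g := fun _ => M - K), Finset.prod_const,
    Finset.card_erase_of_mem hs, Finset.prod_congr rfl (g := fun _ => M), Finset.prod_const,
    Finset.card_compl]
  · push_cast [hKM]
    rw [mul_assoc, ← pow_add, Nat.sub_add_cancel (Finset.card_le_univ I)]
  · intro t ht
    rw [Finset.mem_compl] at ht
    rw [if_neg (ne_of_mem_of_not_mem hs ht).symm, if_neg ht, Finset.card_univ, Fintype.card_fin]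
  · intro t ht
    rw [Finset.mem_erase] at ht
    rw [if_neg ht.1, if_pos ht.2, hge]

/-- The random set `levelSet y` meets a set `I` exactly in the given point `s` with probability at
least `1 / (8 * (l + 2) * #I)`: the density adapted to `#I` is chosen with probability
`1 / (l + 2)`. -/
theorem card_le_mul_card_filter_levelSet {σ : Type*} [Fintype σ] [DecidableEq σ] {l : ℕ}
    (hσ : Fintype.card σ ≤ 2 ^ l) (I : Finset σ) {s : σ} (hs : s ∈ I) :
    (Fintype.card (Fin (l + 2) × (σ → Fin (2 ^ (l + 1)))) : ℝ) ≤
      8 * (l + 2) * I.card * ((Finset.univ.filter fun y : Fin (l + 2) × (σ → Fin (2 ^ (l + 1))) =>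
        s ∈ levelSet y ∧ ∀ t ∈ I, t ∈ levelSet y → t = s).card : ℝ) := by
  have hc : 1 ≤ I.card := Finset.card_pos.2 ⟨s, hs⟩
  -- the density `2 ^ (-i)` adapted to `I`: `2 * #I ≤ 2 ^ i < 4 * #I`
  obtain ⟨i, hi1, hi2, hi⟩ : ∃ i, 2 * I.card ≤ 2 ^ i ∧ 2 ^ i < 4 * I.card ∧ i ≤ l + 1 := by
    have h2 : 1 < 2 * I.card := by omega
    refine ⟨Nat.clog 2 (2 * I.card), Nat.le_pow_clog one_lt_two _, ?_, ?_⟩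
    · have := Nat.pow_pred_clog_lt_self one_lt_two h2
      have hpos := Nat.clog_pos one_lt_two h2
      obtain ⟨j, hj⟩ := Nat.exists_eq_succ_of_ne_zero hpos.ne'
      rw [hj] at this ⊢
      rw [Nat.pred_succ] at this
      rw [pow_succ]
      omega
    · refine Nat.clog_le_of_le_pow ?_
      have := I.card_le_univ
      rw [pow_succ]
      omega
  set M : ℕ := 2 ^ (l + 1) with hM
  set K : ℕ := 2 ^ (l + 1 - i) with hK
  have hMK : M = K * 2 ^ i := by rw [hM, hK, ← pow_add, Nat.sub_add_cancel hi]
  have hKpos : 0 < K := by positivity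
  have hKM : K ≤ M := hMK ▸ Nat.le_mul_of_pos_right _ (by positivity)
  set N := (Finset.univ.filter fun h : σ → Fin M =>
      (h s : ℕ) < K ∧ ∀ t ∈ I, (h t : ℕ) < K → t = s).card with hN
  have hNle : N ≤ (Finset.univ.filter fun y : Fin (l + 2) × (σ → Fin M) =>
        s ∈ levelSet y ∧ ∀ t ∈ I, t ∈ levelSet y → t = s).card := by
    refine Finset.card_le_card_of_injOn (fun h => (⟨i, by omega⟩, h)) (fun h hh => ?_)
      fun h _ h' _ e => (Prod.ext_iff.1 e).2
    simpa [levelSet] using hh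
  have hcount := card_filter_isolated hKM I hs
  rw [← hN] at hcount
  have hq : (M : ℝ) = K * 2 ^ i := by exact_mod_cast hMK
  have hKr : (0 : ℝ) < K := by exact_mod_cast hKpos
  have hMr : (0 : ℝ) < M := by rw [hq]; positivity
  have hq0 : (0 : ℝ) < 2 ^ i := by positivity
  have hi1' : 2 * (I.card : ℝ) ≤ 2 ^ i := by exact_mod_cast hi1
  have hi2' : (2 : ℝ) ^ i ≤ 4 * I.card := by exact_mod_cast hi2.le
  have hcr : (1 : ℝ) ≤ I.card := by exact_mod_cast hc
  -- Bernoulli's inequality bounds the probability that no other point of `I` is chosen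
  have hbern : 1 / 2 * (M : ℝ) ^ (I.card - 1) ≤ (M - K : ℝ) ^ (I.card - 1) := by
    have hb := one_add_mul_le_pow (a := -(1 / (2 : ℝ) ^ i)) (by
      have : 1 / (2 : ℝ) ^ i ≤ 1 := by rw [div_le_one hq0]; linarith
      linarith) (I.card - 1)
    have hhalf : 1 / 2 ≤ 1 + ((I.card - 1 : ℕ) : ℝ) * -(1 / (2 : ℝ) ^ i) := by
      rw [Nat.cast_sub hc, Nat.cast_one]
      have : ((I.card : ℝ) - 1) * (1 / 2 ^ i) ≤ 1 / 2 := by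
        rw [mul_one_div, div_le_div_iff₀ hq0 two_pos]
        linarith
      linarith
    rw [show (M - K : ℝ) = (1 + -(1 / 2 ^ i)) * M by rw [hq]; field_simp; ring, mul_pow]
    gcongr
    exact hhalf.trans hb
  have hmain : (M : ℝ) ^ Fintype.card σ ≤ 8 * I.card * N := by
    have h1 : (M : ℝ) ^ I.card ≤ 8 * I.card * (K * (M - K : ℝ) ^ (I.card - 1)) := by
      calc (M : ℝ) ^ I.card = M * M ^ (I.card - 1) := by
            rw [← pow_succ', Nat.sub_add_cancel hc]
        _ ≤ (4 * I.card * K) * M ^ (I.card - 1) := by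
            gcongr
            rw [hq, mul_comm]
            gcongr
        _ = 8 * I.card * (K * (1 / 2 * M ^ (I.card - 1))) := by ring
        _ ≤ _ := by gcongr
    refine le_of_mul_le_mul_right ?_ (show (0 : ℝ) < M ^ I.card by positivity)
    calc (M : ℝ) ^ Fintype.card σ * M ^ I.card
        ≤ M ^ Fintype.card σ * (8 * I.card * (K * (M - K : ℝ) ^ (I.card - 1))) := by gcongr
      _ = 8 * I.card * N * M ^ I.card := by rw [mul_assoc _ (N : ℝ), hcount]; ring
  rw [Fintype.card_prod, Fintype.card_fun, Fintype.card_fin, Fintype.card_fin]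
  rw [Nat.cast_mul, Nat.cast_pow, Nat.cast_add, Nat.cast_ofNat]
  refine le_trans ?_ (mul_le_mul_of_nonneg_left (Nat.cast_le.2 hNle) (by positivity))
  calc (l + 2 : ℝ) * (M : ℝ) ^ Fintype.card σ ≤ (l + 2) * (8 * I.card * N) := by gcongr
    _ = 8 * (l + 2) * I.card * N := by ring

variable {G : Type*} [Group G]

open Classical in
/-- Each `g` in `S * F` is counted with total weight `1`, shared equally among its factorizations
`g = s * f`. -/
theorem sum_inv_card_eq_card_mul (S F : Finset G) :
    ∑ f ∈ F, ∑ s : S, (1 : ℝ) / (Finset.univ.filter fun t : S => (t : G)⁻¹ * (s * f) ∈ F).card =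
      (S * F).card := by
  rw [← Finset.sum_product', Finset.card_eq_sum_ones, Nat.cast_sum,
    ← Finset.sum_fiberwise_of_maps_to (t := S * F) (g := fun p : G × S => (p.2 : G) * p.1)
      (fun p hp => Finset.mul_mem_mul p.2.2 (Finset.mem_product.1 hp).1)]
  refine Finset.sum_congr rfl fun g hg => ?_
  have hcard : ((F ×ˢ (Finset.univ : Finset S)).filter fun p => (p.2 : G) * p.1 = g).card =
      (Finset.univ.filter fun t : S => (t : G)⁻¹ * g ∈ F).card := by
    refine Finset.card_nbij' (fun p => p.2) (fun t => ((t : G)⁻¹ * g, t)) ?_ ?_ ?_ ?_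
    · rintro ⟨f, t⟩ h
      simp only [Finset.coe_filter, Finset.mem_product, Set.mem_ofPred_eq] at h ⊢
      simpa [← h.2] using h.1.1
    · intro t h
      simpa using h
    · rintro ⟨f, t⟩ h
      simp only [Finset.coe_filter, Finset.mem_product, Set.mem_ofPred_eq] at h
      simp [← h.2]
    · intro t _
      rfl
  rw [Finset.sum_congr rfl (g := fun _ => (1 : ℝ) /
      (Finset.univ.filter fun t : S => (t : G)⁻¹ * g ∈ F).card), Finset.sum_const, hcard,
    nsmul_eq_mul, Nat.cast_one]
  · obtain ⟨s, hs, f, hf, rfl⟩ := Finset.mem_mul.1 hg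
    refine mul_one_div_cancel (Nat.cast_ne_zero.2 (Finset.card_pos.2 ⟨⟨s, hs⟩, ?_⟩).ne')
    simpa using hf
  · intro p hp
    rw [(Finset.mem_filter.1 hp).2]

open Classical in
/-- In a group that is not amenable there is a finite family `Z` of subsets of a finite set `S` such
that every nonempty finite `F` has a point `f` for which the pairs `(s, y)` with `s ∈ Z y`, such
that `s * f` has no other factorization with factors in `Z y` and `F`, outnumber the family. -/
theorem exists_isolating_family {G : Type u} [Group G] (h : ¬ IsAmenableGroup G) :
    ∃ (S : Finset G) (Y : Type u) (_ : Fintype Y) (Z : Y → Finset S),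
      ∀ F : Finset G, F.Nonempty → ∃ f ∈ F, Fintype.card Y <
        (Finset.univ.filter fun p : S × Y =>
          p.1 ∈ Z p.2 ∧ ∀ t ∈ Z p.2, (t : G)⁻¹ * (p.1 * f) ∈ F → t = p.1).card := by
  obtain ⟨S, l, hS, hF⟩ := exists_card_le_two_pow_and_card_mul_gt h
  refine ⟨S, Fin (l + 2) × (S → Fin (2 ^ (l + 1))), inferInstance, levelSet, fun F hne => ?_⟩
  obtain ⟨f, hf, hlt⟩ : ∃ f ∈ F, 8 * (l + 2 : ℝ) <
      ∑ s : S, (1 : ℝ) / (Finset.univ.filter fun t : S => (t : G)⁻¹ * (s * f) ∈ F).card := by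
    refine Finset.exists_lt_of_sum_lt ?_
    rw [sum_inv_card_eq_card_mul, Finset.sum_const, nsmul_eq_mul, mul_comm]
    exact hF F hne
  refine ⟨f, hf, ?_⟩
  set Y := Fin (l + 2) × (S → Fin (2 ^ (l + 1)))
  have hYpos : (0 : ℝ) < Fintype.card Y := by exact_mod_cast Fintype.card_pos
  have hcard : (Finset.univ.filter fun p : S × Y => p.1 ∈ levelSet p.2 ∧
      ∀ t ∈ levelSet p.2, (t : G)⁻¹ * (p.1 * f) ∈ F → t = p.1).card =
      ∑ s : S, (Finset.univ.filter fun y : Y => s ∈ levelSet y ∧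
        ∀ t ∈ levelSet y, (t : G)⁻¹ * (s * f) ∈ F → t = s).card := by
    simp only [Finset.card_filter, Fintype.sum_prod_type]
  rw [hcard, ← Nat.cast_lt (α := ℝ), Nat.cast_sum]
  have hs : ∀ s : S, (Fintype.card Y : ℝ) / (8 * (l + 2)) *
      (1 / (Finset.univ.filter fun t : S => (t : G)⁻¹ * (s * f) ∈ F).card) ≤
      (Finset.univ.filter fun y : Y => s ∈ levelSet y ∧
        ∀ t ∈ levelSet y, (t : G)⁻¹ * (s * f) ∈ F → t = s).card := by
    intro s
    have hsI : s ∈ Finset.univ.filter fun t : S => (t : G)⁻¹ * (s * f) ∈ F := by simpa using hf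
    have := card_le_mul_card_filter_levelSet (by simpa using hS) _ hsI
    have hpos : (0 : ℝ) < (Finset.univ.filter fun t : S => (t : G)⁻¹ * (s * f) ∈ F).card := by
      exact_mod_cast Finset.card_pos.2 ⟨s, hsI⟩
    rw [div_mul_div_comm, mul_one, div_le_iff₀ (by positivity), mul_comm]
    refine this.trans (le_of_eq ?_)
    congr 3
    ext y
    simp only [Finset.mem_filter, Finset.mem_univ, true_and]
    exact and_congr_right fun _ => forall_congr' fun t => forall_comm
  calc (Fintype.card Y : ℝ) = Fintype.card Y / (8 * (l + 2)) * (8 * (l + 2)) := by field_simp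
    _ < Fintype.card Y / (8 * (l + 2)) * ∑ s : S, (1 : ℝ) /
        (Finset.univ.filter fun t : S => (t : G)⁻¹ * (s * f) ∈ F).card := by gcongr
    _ ≤ _ := by
      rw [Finset.mul_sum]
      exact Finset.sum_le_sum fun s _ => hs s

end Combinatorics

/-! ### The strong rank condition for group algebras -/

section GroupAlgebra

theorem exists_finiteDimensional_injective (k : Type u) [Field k] (T : Type*) [Finite T] :
    ∃ (L : Type u) (_ : Field L) (_ : Algebra k L) (_ : FiniteDimensional k L) (α : T → L),
      Function.Injective α := by
  obtain ⟨n, ⟨e⟩⟩ := Finite.exists_equiv_fin T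
  let j : T → AlgebraicClosure k := fun t => Infinite.natEmbedding (AlgebraicClosure k) (e t)
  have hj : Function.Injective j := fun s t h =>
    e.injective (Fin.ext ((Infinite.natEmbedding _).injective h))
  refine ⟨IntermediateField.adjoin k (Set.range j), inferInstance, inferInstance,
    IntermediateField.finiteDimensional_adjoin fun x _ => Algebra.IsIntegral.isIntegral x,
    fun t => ⟨j t, IntermediateField.subset_adjoin _ _ ⟨t, rfl⟩⟩, fun s t h => hj ?_⟩
  exact congrArg Subtype.val h

/-- Left multiplication by a matrix over `R`, as a homomorphism of free right `R`-modules. -/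
def Matrix.mulVecRight {R ι κ : Type*} [Ring R] [Fintype ι] (A : Matrix κ ι R) :
    (ι → R) →ₗ[Rᵐᵒᵖ] (κ → R) where
  toFun x := A.mulVec x
  map_add' x y := A.mulVec_add x y
  map_smul' r x := by
    ext j
    simp [Matrix.mulVec, dotProduct, Finset.sum_mul, mul_assoc]

/-- Over the group algebra of a group that is not amenable there is a matrix with more columns than
rows whose left multiplication is injective, that is, the strong rank condition fails. -/
theorem exists_injective_mulVecRight (k : Type*) {G : Type u} [Field k] [Group G]
    (h : ¬ IsAmenableGroup G) :
    ∃ (ι : Type) (κ : Type u) (_ : Fintype ι) (_ : Fintype κ) (A : Matrix κ ι (MonoidAlgebra k G)),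
      Fintype.card κ < Fintype.card ι ∧ Function.Injective A.mulVecRight := by
  classical
  obtain ⟨S, Y, _, Z, hZ⟩ := exists_isolating_family h
  obtain ⟨L, _, _, _, α, hα⟩ := exists_finiteDimensional_injective k (S × Y)
  let b := Module.finBasis k L
  have hd : 0 < Module.finrank k L := Module.finrank_pos
  -- the matrix over `k` of the map `(X i) ↦ (∑ s ∈ Z y, ∑ i, α (s, y) ^ i * s * X i)` over `L`
  let A : Matrix (Y × Fin (Module.finrank k L))
      (Fin (Fintype.card Y + 1) × Fin (Module.finrank k L)) (MonoidAlgebra k G) :=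
    fun yp ia => ∑ s ∈ Z yp.1,
      MonoidAlgebra.single (s : G) (b.repr (α (s, yp.1) ^ (ia.1 : ℕ) * b ia.2) yp.2)
  refine ⟨_, _, inferInstance, inferInstance, A, ?_, (injective_iff_map_eq_zero _).2 fun x hx => ?_⟩
  · simp only [Fintype.card_prod, Fintype.card_fin]
    gcongr
    omega
  by_contra hx0
  let F : Finset G := Finset.univ.biUnion fun i => (x i).coeff.support
  have hF : ∀ g, g ∉ F → ∀ i, (x i).coeff g = 0 := by
    intro g hg i
    by_contra hne
    exact hg (Finset.mem_biUnion.2 ⟨i, Finset.mem_univ i, Finsupp.mem_support_iff.2 hne⟩)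
  have hFne : F.Nonempty := by
    by_contra hemp
    rw [Finset.not_nonempty_iff_eq_empty] at hemp
    refine hx0 (funext fun i => MonoidAlgebra.coeff_injective (Finsupp.ext fun g => ?_))
    exact hF g (by simp [hemp]) i
  obtain ⟨f, hf, hcard⟩ := hZ F hFne
  let X : Fin (Fintype.card Y + 1) → L := fun i => ∑ a, (x (i, a)).coeff f • b a
  -- the coefficient of the image of `x` at `s * f` in row `y` only involves the isolated point `s`
  have hroot : ∀ (s : S) (y : Y), s ∈ Z y → (∀ t ∈ Z y, (t : G)⁻¹ * (s * f) ∈ F → t = s) →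
      ∑ i : Fin (Fintype.card Y + 1), α (s, y) ^ (i : ℕ) * X i = 0 := by
    intro s y hs hiso
    refine b.repr.map_eq_zero_iff.1 (Finsupp.ext fun p => ?_)
    have hcoeff := congrArg (fun r : MonoidAlgebra k G => r.coeff (s * f)) (congrFun hx (y, p))
    rw [Finsupp.zero_apply, ← show ((0 : MonoidAlgebra k G).coeff (s * f)) = 0 from rfl]
    refine Eq.trans ?_ hcoeff
    simp only [Matrix.mulVecRight, LinearMap.coe_mk, AddHom.coe_mk, Matrix.mulVec, dotProduct, A,
      Finset.sum_mul, MonoidAlgebra.coeff_sum, Finsupp.finsetSum_apply,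
      MonoidAlgebra.coeff_single_mul_apply, map_sum, X, Finset.mul_sum, mul_smul_comm, map_smul,
      Finsupp.smul_apply, smul_eq_mul, Fintype.sum_prod_type]
    refine Finset.sum_congr rfl fun i _ => Finset.sum_congr rfl fun a _ => ?_
    rw [Finset.sum_eq_single_of_mem s hs fun t ht hts => ?_, inv_mul_cancel_left, mul_comm]
    rw [hF _ (fun hmem => hts (hiso t ht hmem)), mul_zero]
  -- there are more isolated pairs than the size of `Y`, so a Vandermonde determinant is invertible
  have hX : X = 0 := by
    obtain ⟨e⟩ : Nonempty (Fin (Fintype.card Y + 1) ↪ (Finset.univ.filter fun p : S × Y =>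
        p.1 ∈ Z p.2 ∧ ∀ t ∈ Z p.2, (t : G)⁻¹ * (p.1 * f) ∈ F → t = p.1)) :=
      Function.Embedding.nonempty_of_card_le (by
        rw [Fintype.card_fin, Fintype.card_coe]
        exact hcard)
    refine Matrix.eq_zero_of_forall_index_sum_pow_mul_eq_zero (f := fun i => α (e i).1)
      (hα.comp (Subtype.val_injective.comp e.injective)) fun j => ?_
    have := (Finset.mem_filter.1 (e j).2).2
    exact hroot _ _ this.1 this.2
  obtain ⟨⟨i, a⟩, -, hia⟩ := Finset.mem_biUnion.1 hf
  refine Finsupp.mem_support_iff.1 hia ?_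
  exact Fintype.linearIndependent_iff.1 b.linearIndependent _ (congrFun hX i) a

end GroupAlgebra

theorem mainTheorem11 {k G : Type*} [Field k] [Group G]
    (h : ∃ α : WithBot Ordinal.{w}, IsRightKrullDim (MonoidAlgebra k G) α) :
    IsAmenableGroup G := by
  by_contra hG
  obtain ⟨ι, κ, _, _, A, hcard, hA⟩ := exists_injective_mulVecRight k hG
  obtain ⟨F, hF⟩ := exists_strictMono_rat_submodule hcard A.mulVecRight hA
  obtain ⟨α, hα⟩ := h
  exact not_isDeviation_of_strictMono_rat α _ F hF (fun q => Set.mem_univ _) hα
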